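/- Let $n\ge 1$, let $\Omega\subset\mathbb R^n$ be a smooth bounded domain, and let $\gamma\in C^3[0,\infty)$ satisfy $\gamma>0$ and $\gamma'\le 0$ on $(0,\infty)$. Let $u_0\in C^0(\overline\Omega)$ with $u_0\ge 0$, $u_0\not\equiv 0$, and let $v_0=(I-\Delta)^{-1}u_0$, where $\Delta$ is the Laplacian on $C(\overline\Omega)$ with homogeneous Neumann boundary condition (the closure of the Laplacian acting on the functions $w\in C^2(\overline\Omega)$ with $\partial_\nu w=0$ on $\partial\Omega$). Let $\mu\in\mathbb R$, $T\in(0,\infty]$, and let $(u,v)$, with $u,v\in C^0(\overline\Omega\times[0,T))\cap C^{2,1}(\overline\Omega\times(0,T))$ and with $v$ taking values in the domain $[0,\infty)$ of $\gamma$, be a classical solution of $$\begin{cases}u_t=\Delta(\gamma(v)u)+\mu u(1-u), & x\in\Omega,\ 0<t<T,\\ -\Delta v+v=u, & x\in\Omega,\ 0<t<T,\\ \partial_\nu u=\partial_\nu v=0, & x\in\partial\Omega,\ 0<t<T,\\ u(x,0)=u_0(x), & x\in\Omega.\end{cases}$$ Let $v_*=0$ or, more generally, let $v_*\ge 0$ be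 any constant such that $v\ge v_*$ in $\Omega\times(0,T)$. If $\mu>\gamma(v_*)$, then for all $(x,t)\in\Omega\times[0,T)$ $$v(x,t)\le v_0(x)+\frac{\mu}{\mu-\gamma(v_*)}.$$ -/

import Mathlib

open scoped ContDiff Topology Gradient

/-- `ρ` is a smooth local defining function of the set `Ω` at the point `x₀`: near `x₀`, the set `Ω`
is `{ρ < 0}`, and `ρ` vanishes at `x₀` with non-zero gradient. -/
def IsLocalDefiningFunction {n : ℕ} (Ω : Set (EuclideanSpace ℝ (Fin n)))
    (x₀ : EuclideanSpace ℝ (Fin n)) (ρ : EuclideanSpace ℝ (Fin n) → ℝ) : Prop :=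
  ContDiff ℝ ∞ ρ ∧ ρ x₀ = 0 ∧ ∇ ρ x₀ ≠ 0 ∧ ∀ᶠ x in 𝓝 x₀, (x ∈ Ω ↔ ρ x < 0)

/-- A smooth bounded domain of `ℝⁿ`: a bounded connected (hence non-empty) open set that lies, near
each of its boundary points, on one side of a smooth hypersurface. -/
structure IsSmoothBoundedDomain {n : ℕ} (Ω : Set (EuclideanSpace ℝ (Fin n))) : Prop where
  isOpen : IsOpen Ω
  isConnected : IsConnected Ω
  isBounded : Bornology.IsBounded Ω
  smooth_boundary : ∀ x ∈ frontier Ω, ∃ ρ, IsLocalDefiningFunction Ω x ρ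

/-- `ν` is the outward unit normal of `Ω` at the boundary point `x`. -/
def IsOutwardUnitNormal {n : ℕ} (Ω : Set (EuclideanSpace ℝ (Fin n)))
    (x ν : EuclideanSpace ℝ (Fin n)) : Prop :=
  ∃ ρ, IsLocalDefiningFunction Ω x ρ ∧ ν = ‖∇ ρ x‖⁻¹ • ∇ ρ x

/-- The homogeneous Neumann condition `∂w/∂ν = 0` on `∂Ω`, for a function `w` that is differentiable
up to the boundary. -/
def HasZeroNormalDerivative {n : ℕ} (Ω : Set (EuclideanSpace ℝ (Fin n)))
    (w : EuclideanSpace ℝ (Fin n) → ℝ) : Prop :=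
  ∀ x ∈ frontier Ω, ∀ ν, IsOutwardUnitNormal Ω x ν → fderivWithin ℝ w (closure Ω) x ν = 0

/-- `g = (I - Δ)⁻¹ f`, where `Δ` is the Laplacian on `C(closure Ω)` with homogeneous Neumann boundary
condition, that is, the closure of the Laplacian acting on the functions of class `C²` up to the
boundary with zero normal derivative. (If `g` is itself such a function, constant sequences show that
this holds as soon as `g - Δ g = f` in `Ω`; for a merely continuous `f`, the function `g` need not
be of class `C²`.) -/
def IsNeumannResolvent {n : ℕ} (Ω : Set (EuclideanSpace ℝ (Fin n)))
    (f g : EuclideanSpace ℝ (Fin n) → ℝ) : Prop :=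
  ∃ w : ℕ → EuclideanSpace ℝ (Fin n) → ℝ,
    (∀ k, ContDiffOn ℝ 2 (w k) (closure Ω)) ∧
    (∀ k, HasZeroNormalDerivative Ω (w k)) ∧
    TendstoUniformlyOn w g Filter.atTop (closure Ω) ∧
    TendstoUniformlyOn (fun k x => w k x - Laplacian.laplacian (w k) x) f Filter.atTop Ω

/-- The class `C⁰(closure Ω × [0,T)) ∩ C^{2,1}(closure Ω × (0,T))`, with `T ∈ (0,∞]`; the time
variable is written first. -/
structure IsClassicalRegular {n : ℕ} (Ω : Set (EuclideanSpace ℝ (Fin n))) (T : EReal)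
    (w : ℝ → EuclideanSpace ℝ (Fin n) → ℝ) : Prop where
  continuousOn : ContinuousOn (fun q : ℝ × EuclideanSpace ℝ (Fin n) => w q.1 q.2)
    ({t : ℝ | 0 ≤ t ∧ (t : EReal) < T} ×ˢ closure Ω)
  contDiffOn_space : ∀ t : ℝ, 0 < t → (t : EReal) < T → ContDiffOn ℝ 2 (w t) (closure Ω)
  differentiableAt_time : ∀ t : ℝ, 0 < t → (t : EReal) < T → ∀ x ∈ closure Ω,
    DifferentiableAt ℝ (fun s => w s x) t
  continuousOn_deriv_time : ContinuousOn
    (fun q : ℝ × EuclideanSpace ℝ (Fin n) => deriv (fun s => w s q.2) q.1)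
    ({t : ℝ | 0 < t ∧ (t : EReal) < T} ×ˢ closure Ω)
  continuousOn_fderiv : ContinuousOn
    (fun q : ℝ × EuclideanSpace ℝ (Fin n) => fderivWithin ℝ (w q.1) (closure Ω) q.2)
    ({t : ℝ | 0 < t ∧ (t : EReal) < T} ×ˢ closure Ω)
  continuousOn_fderiv_fderiv : ContinuousOn
    (fun q : ℝ × EuclideanSpace ℝ (Fin n) =>
      fderivWithin ℝ (fun y => fderivWithin ℝ (w q.1) (closure Ω) y) (closure Ω) q.2)
    ({t : ℝ | 0 < t ∧ (t : EReal) < T} ×ˢ closure Ω)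

/-- The condition on the motility: `γ ∈ C³[0,∞)`, and `γ > 0`, `γ' ≤ 0` on `(0,∞)`. The values of
`γ` at negative arguments play no role. -/
structure IsMotility (γ : ℝ → ℝ) : Prop where
  contDiffOn : ContDiffOn ℝ 3 γ (Set.Ici 0)
  pos : ∀ s : ℝ, 0 < s → 0 < γ s
  deriv_nonpos : ∀ s : ℝ, 0 < s → deriv γ s ≤ 0

/-- The condition on the initial datum: `u₀ ∈ C⁰(closure Ω)`, `u₀ ≥ 0`, `u₀ ≢ 0`. -/
structure IsInitialDatum {n : ℕ} (Ω : Set (EuclideanSpace ℝ (Fin n)))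
    (u₀ : EuclideanSpace ℝ (Fin n) → ℝ) : Prop where
  continuousOn : ContinuousOn u₀ (closure Ω)
  nonneg : ∀ x ∈ closure Ω, 0 ≤ u₀ x
  not_zero : ∃ x ∈ closure Ω, u₀ x ≠ 0

/-- `(u, v)` is a classical solution on `Ω × [0,T)` of
`u_t = Δ(γ(v) u) + μ u (1 - u)`, `-Δ v + v = u` in `Ω × (0,T)`, with `∂u/∂ν = ∂v/∂ν = 0` on
`∂Ω × (0,T)` and `u(·,0) = u₀` in `Ω`. As `γ` is a function on `[0,∞)`, the expression `γ(v)` has a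
meaning only if `v` takes its values there; this is the field `mem_domain`. -/
structure IsClassicalSolution {n : ℕ} (Ω : Set (EuclideanSpace ℝ (Fin n))) (γ : ℝ → ℝ) (μ : ℝ)
    (u₀ : EuclideanSpace ℝ (Fin n) → ℝ) (T : EReal)
    (u v : ℝ → EuclideanSpace ℝ (Fin n) → ℝ) : Prop where
  regular_u : IsClassicalRegular Ω T u
  regular_v : IsClassicalRegular Ω T v
  mem_domain : ∀ t : ℝ, 0 < t → (t : EReal) < T → ∀ x ∈ Ω, v t x ∈ Set.Ici (0 : ℝ)
  eq_u : ∀ t : ℝ, 0 < t → (t : EReal) < T → ∀ x ∈ Ω,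
    deriv (fun s => u s x) t =
      Laplacian.laplacian (fun y => γ (v t y) * u t y) x + μ * u t x * (1 - u t x)
  eq_v : ∀ t : ℝ, 0 < t → (t : EReal) < T → ∀ x ∈ Ω,
    -Laplacian.laplacian (v t) x + v t x = u t x
  neumann_u : ∀ t : ℝ, 0 < t → (t : EReal) < T → HasZeroNormalDerivative Ω (u t)
  neumann_v : ∀ t : ℝ, 0 < t → (t : EReal) < T → HasZeroNormalDerivative Ω (v t)
  initial : ∀ x ∈ Ω, u 0 x = u₀ x

/-!
Write `A = I - Δ` with the Neumann condition and `y = γ(v) u`. Applying `A⁻¹` to the equation for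
`u` gives `v_t + y + c v = A⁻¹ (y + c u + μ u (1 - u))` for each constant `c`. Since `u ≥ 0` and
`γ(v) ≤ γ(vstar)`, the choice `c = γ(vstar) + μ` makes the source at most
`2 c u - μ u ^ 2 ≤ c ^ 2 / μ`; then `v_t + c v ≤ c ^ 2 / μ`, so `v ≤ v₀ + c / μ`, and
`c / μ = 1 + γ(vstar) / μ ≤ μ / (μ - γ(vstar))`.

No existence theory for `A⁻¹` enters. All that is used of it is the comparison principle
`IsNeumannRegular.le_of_sub_laplacianWithin_le`, applied to difference quotients of `v` in time
(`IsClassicalSolution.mul_deriv_v_add_le`) and to the approximations that define `v₀`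
(`IsClassicalSolution.v_zero_eq`).

The maximum principle is proved directly up to the boundary, without the Hopf lemma: at a boundary
minimum of a `C²` function with vanishing normal derivative the whole gradient vanishes, so the
second derivative is non-negative in the inward directions, and by evenness and density in all
directions (`IsNeumannRegular.laplacianWithin_nonneg`). The Laplacian at the boundary is
`laplacianWithin` on the closure, which is legitimate because the inward directions make the closure
a set of unique differentiability.

The non-negativity of `u` (`IsClassicalSolution.u_nonneg`) is a parabolic maximum principle for `y`,
whose zero-order coefficient is bounded above down to `t = 0` thanks to a lower bound for `v_t`,
itself a case of `IsClassicalSolution.mul_deriv_v_add_le`.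
-/

open Set Filter InnerProductSpace

/-! ### Inward directions at the points of the closure of a smooth domain -/

section Geometry

variable {n : ℕ} {Ω : Set (EuclideanSpace ℝ (Fin n))} {x₀ : EuclideanSpace ℝ (Fin n)}

/-- The directions `ξ` along which one enters `Ω` immediately from `x₀`. -/
def inwardDirections (Ω : Set (EuclideanSpace ℝ (Fin n))) (x₀ : EuclideanSpace ℝ (Fin n)) :
    Set (EuclideanSpace ℝ (Fin n)) :=
  {ξ | ∀ᶠ s : ℝ in 𝓝[>] 0, x₀ + s • ξ ∈ Ω}

theorem tendsto_add_smul_nhdsGT (x₀ ξ : EuclideanSpace ℝ (Fin n)) :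
    Tendsto (fun s : ℝ => x₀ + s • ξ) (𝓝[>] 0) (𝓝 x₀) := by
  have h : Continuous fun s : ℝ => x₀ + s • ξ := by fun_prop
  simpa using (h.tendsto 0).mono_left nhdsWithin_le_nhds

theorem IsLocalDefiningFunction.mem_inwardDirections {ρ : EuclideanSpace ℝ (Fin n) → ℝ}
    (h : IsLocalDefiningFunction Ω x₀ ρ) {ξ : EuclideanSpace ℝ (Fin n)}
    (hξ : inner ℝ (∇ ρ x₀) ξ < 0) : ξ ∈ inwardDirections Ω x₀ := by
  obtain ⟨hs, h0, -, hΩ⟩ := h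
  have hd : HasFDerivAt ρ (fderiv ℝ ρ x₀) x₀ :=
    (hs.differentiable (by simp)).differentiableAt.hasFDerivAt
  have hg : HasDerivAt (fun s : ℝ => ρ (x₀ + s • ξ)) (inner ℝ (∇ ρ x₀) ξ) 0 := by
    have hl : HasDerivAt (fun s : ℝ => x₀ + s • ξ) ξ 0 := by
      simpa using ((hasDerivAt_id (0 : ℝ)).smul_const ξ).const_add x₀
    have h2 := HasFDerivAt.comp_hasDerivAt (0 : ℝ) (f := fun s : ℝ => x₀ + s • ξ) (l := ρ)
      (l' := fderiv ℝ ρ x₀) (by simpa using hd) hl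
    have h3 : inner ℝ (∇ ρ x₀) ξ = fderiv ℝ ρ x₀ ξ := by
      rw [gradient, toDual_symm_apply]
    rw [h3]; exact h2
  have hsl := (hasDerivWithinAt_iff_tendsto_slope' (s := Ioi (0 : ℝ)) (by simp)).1
    (hg.hasDerivWithinAt (s := Ioi 0))
  have hneg := hsl.eventually (gt_mem_nhds hξ)
  filter_upwards [hneg, self_mem_nhdsWithin, (tendsto_add_smul_nhdsGT x₀ ξ).eventually hΩ]
    with s h1 h2 h3
  rw [h3]
  have h2' : (0 : ℝ) < s := h2
  simp only [slope_def_field, zero_smul, add_zero, h0, sub_zero] at h1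
  by_contra hcon
  exact absurd h1 (not_lt.2 (div_nonneg (not_lt.1 hcon) h2'.le))

theorem IsOpen.inwardDirections_eq_univ (hΩ : IsOpen Ω) (hx : x₀ ∈ Ω) :
    inwardDirections Ω x₀ = univ :=
  eq_univ_of_forall fun ξ => (tendsto_add_smul_nhdsGT x₀ ξ).eventually (hΩ.mem_nhds hx)

theorem IsSmoothBoundedDomain.isCompact_closure (hΩ : IsSmoothBoundedDomain Ω) :
    IsCompact (closure Ω) :=
  Metric.isCompact_of_isClosed_isBounded isClosed_closure hΩ.isBounded.closure

theorem IsSmoothBoundedDomain.mem_or_mem_frontier (hΩ : IsSmoothBoundedDomain Ω)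
    (hx : x₀ ∈ closure Ω) : x₀ ∈ Ω ∨ x₀ ∈ frontier Ω := by
  rw [hΩ.isOpen.frontier_eq]
  by_cases h : x₀ ∈ Ω
  · exact Or.inl h
  · exact Or.inr ⟨hx, h⟩

theorem IsLocalDefiningFunction.inwardDirections_mem_nhds {ρ : EuclideanSpace ℝ (Fin n) → ℝ}
    (h : IsLocalDefiningFunction Ω x₀ ρ) : inwardDirections Ω x₀ ∈ 𝓝 (-∇ ρ x₀) := by
  have hc : Continuous fun ξ : EuclideanSpace ℝ (Fin n) => inner ℝ (∇ ρ x₀) ξ := by fun_prop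
  have hlt : inner ℝ (∇ ρ x₀) (-∇ ρ x₀) < 0 := by
    rw [inner_neg_right, neg_lt_zero]
    exact real_inner_self_pos.2 h.2.2.1
  filter_upwards [hc.continuousAt.eventually (gt_mem_nhds hlt)] with ξ hξ
  exact h.mem_inwardDirections hξ

theorem IsSmoothBoundedDomain.exists_inwardDirections_mem_nhds (hΩ : IsSmoothBoundedDomain Ω)
    (hx : x₀ ∈ closure Ω) : ∃ ζ, inwardDirections Ω x₀ ∈ 𝓝 ζ := by
  rcases hΩ.mem_or_mem_frontier hx with h | h
  · exact ⟨0, by rw [hΩ.isOpen.inwardDirections_eq_univ h]; exact univ_mem⟩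
  · obtain ⟨ρ, hρ⟩ := hΩ.smooth_boundary x₀ h
    exact ⟨-∇ ρ x₀, hρ.inwardDirections_mem_nhds⟩

theorem span_eq_top_of_mem_nhds {C : Set (EuclideanSpace ℝ (Fin n))}
    {ζ : EuclideanSpace ℝ (Fin n)} (h : C ∈ 𝓝 ζ) : Submodule.span ℝ C = ⊤ :=
  Submodule.eq_top_of_nonempty_interior' _
    ⟨ζ, mem_interior_iff_mem_nhds.2 (mem_of_superset h Submodule.subset_span)⟩

theorem inwardDirections_subset_posTangentConeAt :
    inwardDirections Ω x₀ ⊆ posTangentConeAt (closure Ω) x₀ := by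
  intro ξ hξ
  refine mem_posTangentConeAt_of_frequently_mem ?_
  exact (Eventually.mono (show ∀ᶠ s : ℝ in 𝓝[>] 0, x₀ + s • ξ ∈ Ω from hξ)
    fun s hs => subset_closure hs).frequently

theorem inwardDirections_subset_tangentConeAt :
    inwardDirections Ω x₀ ⊆ tangentConeAt ℝ (closure Ω) x₀ := by
  intro ξ hξ
  refine mem_tangentConeAt_of_add_smul_mem (l := 𝓝[>] (0 : ℝ)) (c := id) ?_
    (Eventually.mono (show ∀ᶠ s : ℝ in 𝓝[>] 0, x₀ + s • ξ ∈ Ω from hξ)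
      fun s hs => subset_closure hs)
  exact tendsto_id.mono_left (nhdsWithin_mono _ fun s hs => ne_of_gt hs)

theorem IsSmoothBoundedDomain.uniqueDiffOn (hΩ : IsSmoothBoundedDomain Ω) :
    UniqueDiffOn ℝ (closure Ω) := by
  intro x hx
  refine ⟨?_, subset_closure hx⟩
  obtain ⟨ζ, hζ⟩ := hΩ.exists_inwardDirections_mem_nhds hx
  have h : Submodule.span ℝ (tangentConeAt ℝ (closure Ω) x) = ⊤ :=
    span_eq_top_of_mem_nhds (mem_of_superset hζ inwardDirections_subset_tangentConeAt)
  rw [h]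
  exact dense_univ

end Geometry

/-! ### The maximum principle up to the boundary -/

section MaximumPrinciple

variable {n : ℕ} {Ω : Set (EuclideanSpace ℝ (Fin n))} {x₀ : EuclideanSpace ℝ (Fin n)}

/-- `w` is in the domain of the classical Neumann Laplacian: it is of class `C²` up to the
boundary and its normal derivative vanishes on the boundary. -/
structure IsNeumannRegular (Ω : Set (EuclideanSpace ℝ (Fin n)))
    (w : EuclideanSpace ℝ (Fin n) → ℝ) : Prop where
  contDiffOn : ContDiffOn ℝ 2 w (closure Ω)
  neumann : HasZeroNormalDerivative Ω w

theorem IsNeumannRegular.differentiableWithinAt {w : EuclideanSpace ℝ (Fin n) → ℝ}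
    (hw : IsNeumannRegular Ω w) (hx : x₀ ∈ closure Ω) :
    DifferentiableWithinAt ℝ w (closure Ω) x₀ :=
  (hw.contDiffOn x₀ hx).differentiableWithinAt (by norm_num)

theorem IsNeumannRegular.const_smul (hΩ : IsSmoothBoundedDomain Ω)
    {w : EuclideanSpace ℝ (Fin n) → ℝ} (hw : IsNeumannRegular Ω w) (a : ℝ) :
    IsNeumannRegular Ω (a • w) := by
  refine ⟨hw.contDiffOn.const_smul a, fun x hx ν hν => ?_⟩
  have hx' := frontier_subset_closure hx
  rw [fderivWithin_const_smul (hΩ.uniqueDiffOn x hx') (hw.differentiableWithinAt hx')]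
  simp [hw.neumann x hx ν hν]

theorem IsNeumannRegular.add (hΩ : IsSmoothBoundedDomain Ω)
    {w z : EuclideanSpace ℝ (Fin n) → ℝ} (hw : IsNeumannRegular Ω w) (hz : IsNeumannRegular Ω z) :
    IsNeumannRegular Ω (w + z) := by
  refine ⟨hw.contDiffOn.add hz.contDiffOn, fun x hx ν hν => ?_⟩
  have hx' := frontier_subset_closure hx
  rw [fderivWithin_add (hΩ.uniqueDiffOn x hx') (hw.differentiableWithinAt hx')
    (hz.differentiableWithinAt hx')]
  simp [hw.neumann x hx ν hν, hz.neumann x hx ν hν]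

theorem IsNeumannRegular.laplacianWithin_smul (hΩ : IsSmoothBoundedDomain Ω)
    {w : EuclideanSpace ℝ (Fin n) → ℝ} (hw : IsNeumannRegular Ω w) (a : ℝ)
    (hx : x₀ ∈ closure Ω) :
    laplacianWithin (a • w) (closure Ω) x₀ = a * laplacianWithin w (closure Ω) x₀ :=
  InnerProductSpace.laplacianWithin_smul a (hw.contDiffOn x₀ hx) hΩ.uniqueDiffOn hx

theorem IsNeumannRegular.laplacianWithin_add (hΩ : IsSmoothBoundedDomain Ω)
    {w z : EuclideanSpace ℝ (Fin n) → ℝ} (hw : IsNeumannRegular Ω w) (hz : IsNeumannRegular Ω z)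
    (hx : x₀ ∈ closure Ω) :
    laplacianWithin (w + z) (closure Ω) x₀ =
      laplacianWithin w (closure Ω) x₀ + laplacianWithin z (closure Ω) x₀ :=
  (hw.contDiffOn x₀ hx).laplacianWithin_add (hz.contDiffOn x₀ hx) hΩ.uniqueDiffOn hx

theorem IsSmoothBoundedDomain.laplacianWithin_eq_sum (hΩ : IsSmoothBoundedDomain Ω)
    (w : EuclideanSpace ℝ (Fin n) → ℝ) (hx : x₀ ∈ closure Ω) :
    laplacianWithin w (closure Ω) x₀ = ∑ i : Fin n,
      fderivWithin ℝ (fderivWithin ℝ w (closure Ω)) (closure Ω) x₀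
        (EuclideanSpace.basisFun (Fin n) ℝ i) (EuclideanSpace.basisFun (Fin n) ℝ i) := by
  rw [laplacianWithin_eq_iteratedFDerivWithin_orthonormalBasis w hΩ.uniqueDiffOn hx
    (EuclideanSpace.basisFun (Fin n) ℝ)]
  simp [iteratedFDerivWithin_two_apply w hΩ.uniqueDiffOn hx]

theorem IsOpen.laplacianWithin_closure (hΩ : IsOpen Ω)
    (w : EuclideanSpace ℝ (Fin n) → ℝ) (hx : x₀ ∈ Ω) :
    laplacianWithin w (closure Ω) x₀ = Laplacian.laplacian w x₀ := by
  have hev : closure Ω =ᶠ[𝓝 x₀] (univ : Set (EuclideanSpace ℝ (Fin n))) := by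
    filter_upwards [hΩ.mem_nhds hx] with y hy
    exact propext ⟨fun _ => trivial, fun _ => subset_closure hy⟩
  simp only [laplacianWithin, ← laplacianWithin_univ, tensorIteratedFDerivWithinTwo,
    bilinearIteratedFDerivWithinTwo]
  have h1 : fderivWithin ℝ w (closure Ω) =ᶠ[𝓝 x₀] fderivWithin ℝ w univ := by
    filter_upwards [hΩ.mem_nhds hx] with y hy
    rw [fderivWithin_univ, fderivWithin_of_mem_nhds (mem_of_superset (hΩ.mem_nhds hy)
      subset_closure)]
  have h2 : fderivWithin ℝ (fderivWithin ℝ w (closure Ω)) (closure Ω) x₀ =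
      fderivWithin ℝ (fderivWithin ℝ w univ) univ x₀ := by
    rw [fderivWithin_univ, fderivWithin_of_mem_nhds (mem_of_superset (hΩ.mem_nhds hx)
      subset_closure)]
    exact h1.fderiv_eq
  rw [h2]

theorem IsNeumannRegular.continuousOn_laplacianWithin (hΩ : IsSmoothBoundedDomain Ω)
    {w : EuclideanSpace ℝ (Fin n) → ℝ} (hw : IsNeumannRegular Ω w) :
    ContinuousOn (laplacianWithin w (closure Ω)) (closure Ω) := by
  have hD : ContDiffOn ℝ 1 (fderivWithin ℝ w (closure Ω)) (closure Ω) :=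
    hw.contDiffOn.fderivWithin hΩ.uniqueDiffOn (by norm_num)
  have hH := hD.continuousOn_fderivWithin hΩ.uniqueDiffOn le_rfl
  refine ContinuousOn.congr (f := fun x => ∑ i : Fin n,
      fderivWithin ℝ (fderivWithin ℝ w (closure Ω)) (closure Ω) x
        (EuclideanSpace.basisFun (Fin n) ℝ i) (EuclideanSpace.basisFun (Fin n) ℝ i)) ?_
    fun x hx => hΩ.laplacianWithin_eq_sum w hx
  exact continuousOn_finsetSum _ fun i _ =>
    (hH.clm_apply continuousOn_const).clm_apply continuousOn_const

/-- At a minimum over the closure the whole gradient vanishes: it is non-negative in the inward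
directions, and on the boundary it vanishes in the normal direction by the Neumann condition. -/
theorem IsNeumannRegular.fderivWithin_eq_zero (hΩ : IsSmoothBoundedDomain Ω)
    {w : EuclideanSpace ℝ (Fin n) → ℝ} (hw : IsNeumannRegular Ω w) (hx : x₀ ∈ closure Ω)
    (hmin : IsMinOn w (closure Ω) x₀) : fderivWithin ℝ w (closure Ω) x₀ = 0 := by
  set L := fderivWithin ℝ w (closure Ω) x₀ with hL
  have hnn : ∀ ξ ∈ inwardDirections Ω x₀, 0 ≤ L ξ := fun ξ hξ =>
    hmin.localize.fderivWithin_nonneg (inwardDirections_subset_posTangentConeAt hξ)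
  -- an inward direction in which `L` vanishes and around which all directions are inward
  obtain ⟨ζ, hζ, hζ0⟩ : ∃ ζ, inwardDirections Ω x₀ ∈ 𝓝 ζ ∧ L ζ = 0 := by
    rcases hΩ.mem_or_mem_frontier hx with h | h
    · exact ⟨0, by rw [hΩ.isOpen.inwardDirections_eq_univ h]; exact univ_mem, map_zero L⟩
    · obtain ⟨ρ, hρ⟩ := hΩ.smooth_boundary x₀ h
      have hν := hw.neumann x₀ h _ ⟨ρ, hρ, rfl⟩
      refine ⟨-∇ ρ x₀, hρ.inwardDirections_mem_nhds, ?_⟩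
      rw [map_smul, smul_eq_mul, mul_eq_zero] at hν
      rw [map_neg, neg_eq_zero]
      exact hν.resolve_left (inv_ne_zero (norm_ne_zero_iff.2 hρ.2.2.1))
  -- `L` is then minimal at `ζ`, an interior point of the inward directions
  have hloc : IsLocalMin (fun ξ => L ξ) ζ := by
    filter_upwards [hζ] with ξ hξ
    rw [hζ0]
    exact hnn ξ hξ
  simpa using hloc.fderiv_eq_zero

theorem IsNeumannRegular.hessian_nonneg_of_inward (hΩ : IsSmoothBoundedDomain Ω)
    {w : EuclideanSpace ℝ (Fin n) → ℝ} (hw : IsNeumannRegular Ω w) (hx : x₀ ∈ closure Ω)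
    (hmin : IsMinOn w (closure Ω) x₀) {ξ : EuclideanSpace ℝ (Fin n)}
    (hξ : ξ ∈ inwardDirections Ω x₀) :
    0 ≤ fderivWithin ℝ (fderivWithin ℝ w (closure Ω)) (closure Ω) x₀ ξ ξ := by
  set D := fderivWithin ℝ w (closure Ω) with hD
  set H := fderivWithin ℝ D (closure Ω) x₀ with hH
  by_contra hneg
  push Not at hneg
  have hD0 : D x₀ = 0 := hw.fderivWithin_eq_zero hΩ hx hmin
  obtain ⟨ε, hε, hin⟩ : ∃ ε > (0 : ℝ), ∀ s ∈ Ioo 0 ε, x₀ + s • ξ ∈ Ω := by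
    obtain ⟨ε, hε, h⟩ := mem_nhdsGT_iff_exists_Ioo_subset.1 hξ
    exact ⟨ε, hε, h⟩
  have hline : ∀ s : ℝ, HasDerivAt (fun s : ℝ => x₀ + s • ξ) ξ s := fun s => by
    simpa using ((hasDerivAt_id s).smul_const ξ).const_add x₀
  have hDdiff : HasFDerivWithinAt D H (closure Ω) x₀ := by
    have h1 : ContDiffOn ℝ 1 D (closure Ω) :=
      hw.contDiffOn.fderivWithin hΩ.uniqueDiffOn (by norm_num)
    exact ((h1 x₀ hx).differentiableWithinAt (by norm_num)).hasFDerivWithinAt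
  have hmaps : MapsTo (fun s : ℝ => x₀ + s • ξ) (Ioo 0 ε) (closure Ω) :=
    fun s hs => subset_closure (hin s hs)
  have hDline : HasDerivWithinAt (fun s : ℝ => D (x₀ + s • ξ) ξ) (H ξ ξ) (Ioo 0 ε) 0 := by
    have h1 := HasFDerivWithinAt.comp_hasDerivWithinAt (0 : ℝ) (f := fun s : ℝ => x₀ + s • ξ)
      (l := D) (l' := H) (t := closure Ω) (by simpa using hDdiff)
      ((hline 0).hasDerivWithinAt (s := Ioo 0 ε)) hmaps
    simpa using h1.clm_apply (hasDerivWithinAt_const (0 : ℝ) (Ioo 0 ε) ξ)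
  have hsl := (hasDerivWithinAt_iff_tendsto_slope' (by simp)).1 hDline
  rw [nhdsWithin_Ioo_eq_nhdsGT hε] at hsl
  obtain ⟨δ, hδ, hDneg⟩ := mem_nhdsGT_iff_exists_Ioo_subset.1
    (hsl.eventually (gt_mem_nhds hneg))
  set r := min (δ / 2) (ε / 2) with hr
  have hδ' : (0 : ℝ) < δ := hδ
  have hr0 : 0 < r := lt_min (by linarith) (by linarith)
  have hrδ : r < δ := (min_le_left _ _).trans_lt (by linarith)
  have hrε : r < ε := (min_le_right _ _).trans_lt (by linarith)
  have hin' : ∀ s ∈ Icc 0 r, x₀ + s • ξ ∈ closure Ω := fun s hs => by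
    rcases hs.1.eq_or_lt with h | h
    · simpa [← h] using hx
    · exact subset_closure (hin s ⟨h, hs.2.trans_lt hrε⟩)
  obtain ⟨s, hs, hse⟩ := exists_hasDerivAt_eq_slope (fun s : ℝ => w (x₀ + s • ξ))
    (fun s => D (x₀ + s • ξ) ξ) hr0
    (hw.contDiffOn.continuousOn.comp (by fun_prop) hin')
    (fun s hs => by
      have hm : x₀ + s • ξ ∈ Ω := hin s ⟨hs.1, hs.2.trans hrε⟩
      have hn : closure Ω ∈ 𝓝 (x₀ + s • ξ) :=
        mem_of_superset (hΩ.isOpen.mem_nhds hm) subset_closure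
      exact ((hw.differentiableWithinAt
        (subset_closure hm)).hasFDerivWithinAt.hasFDerivAt hn).comp_hasDerivAt s (hline s))
  have h1 : slope (fun s : ℝ => D (x₀ + s • ξ) ξ) 0 s < 0 := hDneg ⟨hs.1, hs.2.trans hrδ⟩
  simp only [slope_def_field, zero_smul, add_zero, hD0, sub_zero] at h1
  have h2 : w x₀ ≤ w (x₀ + r • ξ) := hmin (hin' r ⟨hr0.le, le_rfl⟩)
  have h3 : 0 ≤ D (x₀ + s • ξ) ξ := by
    rw [hse]
    simp only [zero_smul, add_zero, sub_zero]
    exact div_nonneg (sub_nonneg.2 h2) hr0.le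
  simp only [zero_apply, sub_zero] at h1
  exact absurd h1 (not_lt.2 (div_nonneg h3 hs.1.le))

/-- The Hessian at a minimum over the closure is non-negative in the inward directions, and by
evenness and density in all directions. -/
theorem IsNeumannRegular.hessian_nonneg (hΩ : IsSmoothBoundedDomain Ω)
    {w : EuclideanSpace ℝ (Fin n) → ℝ} (hw : IsNeumannRegular Ω w) (hx : x₀ ∈ closure Ω)
    (hmin : IsMinOn w (closure Ω) x₀) (η : EuclideanSpace ℝ (Fin n)) :
    0 ≤ fderivWithin ℝ (fderivWithin ℝ w (closure Ω)) (closure Ω) x₀ η η := by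
  rcases hΩ.mem_or_mem_frontier hx with h | h
  · exact hw.hessian_nonneg_of_inward hΩ hx hmin
      (by rw [hΩ.isOpen.inwardDirections_eq_univ h]; trivial)
  obtain ⟨ρ, hρ⟩ := hΩ.smooth_boundary x₀ h
  set H := fderivWithin ℝ (fderivWithin ℝ w (closure Ω)) (closure Ω) x₀ with hH
  have key : ∀ ξ, inner ℝ (∇ ρ x₀) ξ ≤ 0 → 0 ≤ H ξ ξ := by
    intro ξ hξ
    have hcont : Continuous fun s : ℝ => H (ξ - s • ∇ ρ x₀) (ξ - s • ∇ ρ x₀) := by fun_prop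
    have hlim : Tendsto (fun s : ℝ => H (ξ - s • ∇ ρ x₀) (ξ - s • ∇ ρ x₀)) (𝓝[>] 0)
        (𝓝 (H ξ ξ)) := by
      simpa using (hcont.tendsto 0).mono_left nhdsWithin_le_nhds
    refine ge_of_tendsto hlim ?_
    filter_upwards [self_mem_nhdsWithin] with s hs
    refine hw.hessian_nonneg_of_inward hΩ hx hmin (hρ.mem_inwardDirections ?_)
    rw [inner_sub_right, inner_smul_right]
    have := mul_pos (show (0 : ℝ) < s from hs) (real_inner_self_pos.2 hρ.2.2.1)
    linarith
  rcases le_total (inner ℝ (∇ ρ x₀) η) 0 with h' | h'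
  · exact key η h'
  · simpa using key (-η) (by simpa [inner_neg_right] using h')

theorem IsNeumannRegular.laplacianWithin_nonneg (hΩ : IsSmoothBoundedDomain Ω)
    {w : EuclideanSpace ℝ (Fin n) → ℝ} (hw : IsNeumannRegular Ω w) (hx : x₀ ∈ closure Ω)
    (hmin : IsMinOn w (closure Ω) x₀) : 0 ≤ laplacianWithin w (closure Ω) x₀ := by
  rw [hΩ.laplacianWithin_eq_sum w hx]
  exact Finset.sum_nonneg fun i _ => hw.hessian_nonneg hΩ hx hmin _

/-- The comparison principle for `I - Δ` with the Neumann condition. -/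
theorem IsNeumannRegular.le_of_sub_laplacianWithin_le (hΩ : IsSmoothBoundedDomain Ω)
    {w : EuclideanSpace ℝ (Fin n) → ℝ} (hw : IsNeumannRegular Ω w) {M : ℝ}
    (h : ∀ x ∈ Ω, w x - laplacianWithin w (closure Ω) x ≤ M) :
    ∀ x ∈ closure Ω, w x ≤ M := by
  intro x hx
  obtain ⟨x₁, hx₁, hmax⟩ := hΩ.isCompact_closure.exists_isMaxOn ⟨x, hx⟩
    hw.contDiffOn.continuousOn
  have hmin : IsMinOn ((-1 : ℝ) • w) (closure Ω) x₁ := by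
    intro y hy
    have := hmax hy
    simp only [mem_ofPred_eq, Pi.smul_apply, smul_eq_mul] at this ⊢
    linarith
  have hlap := (hw.const_smul hΩ (-1)).laplacianWithin_nonneg hΩ hx₁ hmin
  rw [hw.laplacianWithin_smul hΩ _ hx₁] at hlap
  have hM : w x₁ - laplacianWithin w (closure Ω) x₁ ≤ M :=
    le_on_closure h (hw.contDiffOn.continuousOn.sub (hw.continuousOn_laplacianWithin hΩ))
      continuousOn_const hx₁
  have := hmax hx
  simp only [mem_ofPred_eq] at this
  linarith

end MaximumPrinciple

/-! ### The motility function -/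

section Motility

variable {γ : ℝ → ℝ}

theorem IsMotility.antitoneOn (hγ : IsMotility γ) : AntitoneOn γ (Ici 0) := by
  refine antitoneOn_of_deriv_nonpos (convex_Ici 0) hγ.contDiffOn.continuousOn ?_ ?_
  · exact (hγ.contDiffOn.differentiableOn (by norm_num)).mono interior_subset
  · intro s hs
    rw [interior_Ici] at hs
    exact hγ.deriv_nonpos s hs

theorem IsMotility.pos_of_nonneg (hγ : IsMotility γ) {s : ℝ} (hs : 0 ≤ s) : 0 < γ s :=
  (hγ.pos (s + 1) (by linarith)).trans_le
    (hγ.antitoneOn hs (show (0 : ℝ) ≤ s + 1 by linarith) (by linarith))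

theorem IsMotility.hasDerivWithinAt (hγ : IsMotility γ) {s : ℝ} (hs : 0 ≤ s) :
    HasDerivWithinAt γ (derivWithin γ (Ici 0) s) (Ici 0) s :=
  ((hγ.contDiffOn s hs).differentiableWithinAt (by norm_num)).hasDerivWithinAt

theorem IsMotility.continuousOn_derivWithin (hγ : IsMotility γ) :
    ContinuousOn (derivWithin γ (Ici 0)) (Ici 0) :=
  hγ.contDiffOn.continuousOn_derivWithin (uniqueDiffOn_Ici 0) (by norm_num)

end Motility

/-! ### Functions that are regular in space and time -/

section Regular

variable {n : ℕ} {Ω : Set (EuclideanSpace ℝ (Fin n))} {T : EReal}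
  {w : ℝ → EuclideanSpace ℝ (Fin n) → ℝ} {t : ℝ}

theorem eventually_coe_lt (ht : (t : EReal) < T) : ∀ᶠ s : ℝ in 𝓝 t, (s : EReal) < T :=
  continuous_coe_real_ereal.continuousAt.eventually (gt_mem_nhds ht)

theorem IsClassicalRegular.continuousOn_slice (hw : IsClassicalRegular Ω T w) (h0 : 0 ≤ t)
    (ht : (t : EReal) < T) : ContinuousOn (w t) (closure Ω) :=
  hw.continuousOn.comp (f := fun x => (t, x)) (by fun_prop) fun _ hx => ⟨⟨h0, ht⟩, hx⟩

theorem IsClassicalRegular.continuousOn_time (hw : IsClassicalRegular Ω T w)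
    {x : EuclideanSpace ℝ (Fin n)} (hx : x ∈ closure Ω) :
    ContinuousOn (fun s => w s x) {s : ℝ | 0 ≤ s ∧ (s : EReal) < T} :=
  hw.continuousOn.comp (f := fun s : ℝ => (s, x)) (by fun_prop) fun _ hs => ⟨hs, hx⟩

theorem IsClassicalRegular.tendsto_initial (hw : IsClassicalRegular Ω T w) (hT : 0 < T)
    {x : EuclideanSpace ℝ (Fin n)} (hx : x ∈ closure Ω) :
    Tendsto (fun s => w s x) (𝓝[>] 0) (𝓝 (w 0 x)) := by
  refine (hw.continuousOn_time hx 0 ⟨le_rfl, by simpa using hT⟩).mono_left ?_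
  refine nhdsWithin_le_iff.2 ?_
  filter_upwards [self_mem_nhdsWithin,
    nhdsWithin_le_nhds (eventually_coe_lt (t := 0) (by simpa using hT))] with s h1 h2
  exact ⟨(show (0 : ℝ) < s from h1).le, h2⟩

theorem IsClassicalRegular.hasDerivAt (hw : IsClassicalRegular Ω T w) (h0 : 0 < t)
    (ht : (t : EReal) < T) {x : EuclideanSpace ℝ (Fin n)} (hx : x ∈ closure Ω) :
    HasDerivAt (fun s => w s x) (deriv (fun s => w s x) t) t :=
  (hw.differentiableAt_time t h0 ht x hx).hasDerivAt

/-- The forward difference quotients in time converge to the time derivative, uniformly up to the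
boundary. -/
theorem IsClassicalRegular.eventually_abs_quotient_sub_le (hw : IsClassicalRegular Ω T w)
    (hΩ : IsCompact (closure Ω)) (h0 : 0 < t) (ht : (t : EReal) < T) {δ : ℝ} (hδ : 0 < δ) :
    ∀ᶠ h : ℝ in 𝓝[>] 0, ∀ x ∈ closure Ω,
      |h⁻¹ * (w (t + h) x - w t x) - deriv (fun s => w s x) t| ≤ δ := by
  obtain ⟨V, hV, hVδ⟩ := hΩ.mem_uniformity_of_prod
    (f := fun (s : ℝ) x => deriv (fun r => w r x) s) hw.continuousOn_deriv_time
    (show t ∈ {t : ℝ | 0 < t ∧ (t : EReal) < T} from ⟨h0, ht⟩) (Metric.dist_mem_uniformity hδ)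
  have hV' : V ∩ {t : ℝ | 0 < t ∧ (t : EReal) < T} ∈ 𝓝 t := by
    have h1 : {t : ℝ | 0 < t ∧ (t : EReal) < T} ∈ 𝓝 t :=
      (lt_mem_nhds h0).and (eventually_coe_lt ht)
    rw [nhdsWithin_eq_nhds.2 h1] at hV
    exact inter_mem hV h1
  obtain ⟨ε, hε, hball⟩ := Metric.mem_nhds_iff.1 hV'
  filter_upwards [Ioo_mem_nhdsGT hε] with h hh x hx
  have hmem : ∀ s ∈ Icc t (t + h), s ∈ V ∩ {t : ℝ | 0 < t ∧ (t : EReal) < T} := fun s hs => by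
    refine hball ?_
    rw [Metric.mem_ball, Real.dist_eq, abs_of_nonneg (by linarith [hs.1])]
    linarith [hs.2, hh.2]
  obtain ⟨s, hs, hse⟩ := exists_hasDerivAt_eq_slope (fun s => w s x)
    (fun s => deriv (fun r => w r x) s) (show t < t + h by linarith [hh.1])
    (fun s hs => (hw.hasDerivAt (hmem s hs).2.1 (hmem s hs).2.2
      hx).continuousAt.continuousWithinAt)
    (fun s hs => hw.hasDerivAt (hmem s ⟨hs.1.le, hs.2.le⟩).2.1
      (hmem s ⟨hs.1.le, hs.2.le⟩).2.2 hx)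
  have h1 := hVδ s (hmem s ⟨hs.1.le, hs.2.le⟩).1 x hx
  rw [mem_ofPred_eq, Real.dist_eq, hse, add_sub_cancel_left, div_eq_inv_mul] at h1
  exact h1.le

end Regular

/-! ### Classical solutions -/

section Solution

variable {n : ℕ} {Ω : Set (EuclideanSpace ℝ (Fin n))} {γ : ℝ → ℝ} {μ : ℝ}
  {u₀ : EuclideanSpace ℝ (Fin n) → ℝ} {T : EReal} {u v : ℝ → EuclideanSpace ℝ (Fin n) → ℝ}
  {t : ℝ}

theorem IsClassicalSolution.isNeumannRegular_v (huv : IsClassicalSolution Ω γ μ u₀ T u v)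
    (h0 : 0 < t) (ht : (t : EReal) < T) : IsNeumannRegular Ω (v t) :=
  ⟨huv.regular_v.contDiffOn_space t h0 ht, huv.neumann_v t h0 ht⟩

theorem IsClassicalSolution.v_nonneg (huv : IsClassicalSolution Ω γ μ u₀ T u v)
    (h0 : 0 ≤ t) (ht : (t : EReal) < T) {x : EuclideanSpace ℝ (Fin n)} (hx : x ∈ closure Ω) :
    0 ≤ v t x := by
  have hpos : ∀ s : ℝ, 0 < s → (s : EReal) < T → 0 ≤ v s x := fun s hs hsT =>
    le_on_closure (f := fun _ => (0 : ℝ)) (huv.mem_domain s hs hsT) continuousOn_const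
      (huv.regular_v.continuousOn_slice hs.le hsT) hx
  rcases h0.eq_or_lt with rfl | h0
  · have hT : 0 < T := by simpa using ht
    refine ge_of_tendsto (huv.regular_v.tendsto_initial hT hx) ?_
    filter_upwards [self_mem_nhdsWithin, nhdsWithin_le_nhds (eventually_coe_lt ht)] with s h1 h2
    exact hpos s h1 h2
  · exact hpos t h0 ht

theorem IsClassicalSolution.u_zero_nonneg (huv : IsClassicalSolution Ω γ μ u₀ T u v)
    (hu₀ : IsInitialDatum Ω u₀) (hT : 0 < T) {x : EuclideanSpace ℝ (Fin n)}
    (hx : x ∈ closure Ω) : 0 ≤ u 0 x := by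
  refine le_on_closure (f := fun _ => (0 : ℝ)) (fun y hy => ?_) continuousOn_const
    (huv.regular_u.continuousOn_slice le_rfl (by simpa using hT)) hx
  rw [huv.initial y hy]
  exact hu₀.nonneg y (subset_closure hy)

/-- The flux density `γ(v) u` is of class `C²` up to the boundary, and inherits the Neumann
condition from `u` and `v`. -/
theorem IsClassicalSolution.isNeumannRegular_flux (huv : IsClassicalSolution Ω γ μ u₀ T u v)
    (hΩ : IsSmoothBoundedDomain Ω) (hγ : IsMotility γ) (h0 : 0 < t) (ht : (t : EReal) < T) :
    IsNeumannRegular Ω (fun x => γ (v t x) * u t x) := by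
  have hv := huv.isNeumannRegular_v h0 ht
  have hu : IsNeumannRegular Ω (u t) :=
    ⟨huv.regular_u.contDiffOn_space t h0 ht, huv.neumann_u t h0 ht⟩
  have hmaps : MapsTo (v t) (closure Ω) (Ici 0) := fun x hx => huv.v_nonneg h0.le ht hx
  refine ⟨((hγ.contDiffOn.of_le (by norm_num)).comp hv.contDiffOn hmaps).mul hu.contDiffOn, ?_⟩
  intro x hx ν hν
  have hx' := frontier_subset_closure hx
  have h1 : HasFDerivWithinAt (fun y => γ (v t y))
      (derivWithin γ (Ici 0) (v t x) • fderivWithin ℝ (v t) (closure Ω) x) (closure Ω) x :=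
    (hγ.hasDerivWithinAt (hmaps hx')).comp_hasFDerivWithinAt x
      (hv.differentiableWithinAt hx').hasFDerivWithinAt hmaps
  have h2 := h1.mul (hu.differentiableWithinAt hx').hasFDerivWithinAt
  have h3 := h2.fderivWithin (hΩ.uniqueDiffOn x hx')
  have h4 : (fun x => γ (v t x) * u t x) = (fun y => γ (v t y)) * u t := rfl
  rw [h4, h3]
  simp [hv.neumann x hx ν hν, hu.neumann x hx ν hν]

theorem IsClassicalSolution.v_sub_laplacianWithin (huv : IsClassicalSolution Ω γ μ u₀ T u v)
    (hΩ : IsSmoothBoundedDomain Ω) (h0 : 0 < t) (ht : (t : EReal) < T)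
    {x : EuclideanSpace ℝ (Fin n)} (hx : x ∈ Ω) :
    v t x - laplacianWithin (v t) (closure Ω) x = u t x := by
  rw [hΩ.isOpen.laplacianWithin_closure _ hx, ← huv.eq_v t h0 ht x hx]
  ring

theorem IsClassicalSolution.deriv_u_eq (huv : IsClassicalSolution Ω γ μ u₀ T u v)
    (hΩ : IsSmoothBoundedDomain Ω) (hγ : IsMotility γ) (h0 : 0 < t) (ht : (t : EReal) < T)
    {x : EuclideanSpace ℝ (Fin n)} (hx : x ∈ closure Ω) :
    deriv (fun s => u s x) t =
      laplacianWithin (fun y => γ (v t y) * u t y) (closure Ω) x + μ * u t x * (1 - u t x) := by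
  have hu := huv.regular_u.continuousOn_slice h0.le ht
  have hEq : EqOn (fun x => deriv (fun s => u s x) t) (fun x =>
      laplacianWithin (fun y => γ (v t y) * u t y) (closure Ω) x + μ * u t x * (1 - u t x)) Ω :=
    fun y hy => by
      simp only [hΩ.isOpen.laplacianWithin_closure _ hy]
      exact huv.eq_u t h0 ht y hy
  refine hEq.of_subset_closure (t := closure Ω) ?_ ?_ subset_closure subset_rfl hx
  · exact huv.regular_u.continuousOn_deriv_time.comp (f := fun x => (t, x)) (by fun_prop)
      fun _ hx => ⟨⟨h0, ht⟩, hx⟩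
  · exact ((huv.isNeumannRegular_flux hΩ hγ h0 ht).continuousOn_laplacianWithin hΩ).add
      ((continuousOn_const.mul hu).mul (continuousOn_const.sub hu))

/-- The equation for `v` in the form `v_t + γ(v) u + c v = (I - Δ)⁻¹ (γ(v) u + c u + μ u (1 - u))`,
as a one-sided estimate: `σ = 1` bounds the left-hand side from above, `σ = -1` from below.
The comparison principle is applied with a difference quotient in place of `v_t`, which need not
be twice differentiable in space. -/
theorem IsClassicalSolution.mul_deriv_v_add_le (huv : IsClassicalSolution Ω γ μ u₀ T u v)
    (hΩ : IsSmoothBoundedDomain Ω) (hγ : IsMotility γ) (h0 : 0 < t) (ht : (t : EReal) < T)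
    (σ c K : ℝ)
    (hK : ∀ x ∈ Ω, σ * (γ (v t x) * u t x + c * u t x + μ * u t x * (1 - u t x)) ≤ K)
    {x : EuclideanSpace ℝ (Fin n)} (hx : x ∈ closure Ω) :
    σ * (deriv (fun s => v s x) t + γ (v t x) * u t x + c * v t x) ≤ K := by
  have hy := huv.isNeumannRegular_flux hΩ hγ h0 ht
  set y : EuclideanSpace ℝ (Fin n) → ℝ := fun x => γ (v t x) * u t x with hydef
  have hv := huv.isNeumannRegular_v h0 ht
  have key : ∀ δ > 0, σ * (deriv (fun s => v s x) t + y x + c * v t x) ≤ K + 2 * (|σ| * δ) := by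
    intro δ hδ
    have hT : ∀ᶠ h : ℝ in 𝓝[>] 0, ((t + h : ℝ) : EReal) < T := by
      have h1 : Tendsto (fun h : ℝ => t + h) (𝓝 0) (𝓝 t) := by
        simpa using (continuous_const_add t).tendsto (0 : ℝ)
      exact nhdsWithin_le_nhds (h1.eventually (eventually_coe_lt ht))
    obtain ⟨h, hqu, hqv, hth, hh⟩ := ((huv.regular_u.eventually_abs_quotient_sub_le
      hΩ.isCompact_closure h0 ht hδ).and ((huv.regular_v.eventually_abs_quotient_sub_le
      hΩ.isCompact_closure h0 ht hδ).and (hT.and self_mem_nhdsWithin))).exists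
    have hh : (0 : ℝ) < h := hh
    have hvh := huv.isNeumannRegular_v (show 0 < t + h by linarith) hth
    have hd := hvh.add hΩ (hv.const_smul hΩ (-1))
    have hd' := hd.const_smul hΩ h⁻¹
    have hcv := hv.const_smul hΩ c
    have hs := (hd'.add hΩ hy).add hΩ hcv
    have hW := (hs.const_smul hΩ σ).le_of_sub_laplacianWithin_le hΩ (M := K + |σ| * δ) (by
      intro z hz
      have hz' := subset_closure hz
      rw [hs.laplacianWithin_smul hΩ σ hz', (hd'.add hΩ hy).laplacianWithin_add hΩ hcv hz',
        hd'.laplacianWithin_add hΩ hy hz', hd.laplacianWithin_smul hΩ _ hz',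
        hvh.laplacianWithin_add hΩ (hv.const_smul hΩ (-1)) hz',
        hv.laplacianWithin_smul hΩ _ hz', hv.laplacianWithin_smul hΩ _ hz']
      have e1 := huv.v_sub_laplacianWithin hΩ h0 ht hz
      have e2 := huv.v_sub_laplacianWithin hΩ (show 0 < t + h by linarith) hth hz
      have e3 := huv.deriv_u_eq hΩ hγ h0 ht hz'
      rw [← hydef] at e3
      have e4 := hK z hz
      have e5 : σ * (h⁻¹ * (u (t + h) z - u t z) - deriv (fun s => u s z) t) ≤ |σ| * δ :=
        (le_abs_self _).trans (by
          rw [abs_mul]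
          exact mul_le_mul_of_nonneg_left (hqu z hz') (abs_nonneg σ))
      have e6 : y z = γ (v t z) * u t z := rfl
      simp only [Pi.smul_apply, Pi.add_apply, smul_eq_mul]
      rw [← e6] at e4
      have e7 : laplacianWithin y (closure Ω) z =
        deriv (fun s => u s z) t - μ * u t z * (1 - u t z) := by linarith
      have e8 : laplacianWithin (v t) (closure Ω) z = v t z - u t z := by linarith
      have e9 : laplacianWithin (v (t + h)) (closure Ω) z = v (t + h) z - u (t + h) z := by
        linarith
      rw [e7, e8, e9]
      linarith)
    have hWx := hW x hx
    simp only [Pi.smul_apply, Pi.add_apply, smul_eq_mul] at hWx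
    have e5 : σ * (deriv (fun s => v s x) t - h⁻¹ * (v (t + h) x - v t x)) ≤ |σ| * δ :=
      (le_abs_self _).trans (by
        rw [abs_mul, abs_sub_comm]
        exact mul_le_mul_of_nonneg_left (hqv x hx) (abs_nonneg σ))
    linarith
  refine le_of_forall_pos_le_add fun ε hε => (key (ε / (2 * (|σ| + 1))) (by positivity)).trans ?_
  have h1 : 2 * (|σ| * (ε / (2 * (|σ| + 1)))) ≤ ε := by
    have : 2 * (|σ| * (ε / (2 * (|σ| + 1)))) = ε * (|σ| / (|σ| + 1)) := by
      field_simp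
    rw [this]
    exact mul_le_of_le_one_right hε.le ((div_le_one (by positivity)).2 (by linarith))
  linarith

/-- `v` starts from the resolvent `(I - Δ)⁻¹ u₀`: the comparison principle bounds the distance of
`v(·,t)` to the approximations of the resolvent. -/
theorem IsClassicalSolution.v_zero_eq (huv : IsClassicalSolution Ω γ μ u₀ T u v)
    (hΩ : IsSmoothBoundedDomain Ω) (hT : 0 < T) {v₀ : EuclideanSpace ℝ (Fin n) → ℝ}
    (hv₀ : IsNeumannResolvent Ω u₀ v₀) {x : EuclideanSpace ℝ (Fin n)} (hx : x ∈ Ω) :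
    v 0 x = v₀ x := by
  obtain ⟨w, hwC, hwN, hwv, hwu⟩ := hv₀
  have hx' := subset_closure hx
  have key : ∀ δ > 0, |v 0 x - v₀ x| ≤ 3 * δ := by
    intro δ hδ
    obtain ⟨k, hk1, hk2⟩ := ((Metric.tendstoUniformlyOn_iff.1 hwv δ hδ).and
      (Metric.tendstoUniformlyOn_iff.1 hwu δ hδ)).exists
    have hw : IsNeumannRegular Ω (w k) := ⟨hwC k, hwN k⟩
    obtain ⟨V, hV, hVδ⟩ := hΩ.isCompact_closure.mem_uniformity_of_prod
      (f := u) huv.regular_u.continuousOn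
      (show (0 : ℝ) ∈ {t : ℝ | 0 ≤ t ∧ (t : EReal) < T} from ⟨le_rfl, by simpa using hT⟩)
      (Metric.dist_mem_uniformity hδ)
    have hIoi : 𝓝[>] (0 : ℝ) ≤ 𝓝[{t : ℝ | 0 ≤ t ∧ (t : EReal) < T}] 0 := by
      refine le_inf nhdsWithin_le_nhds (le_principal_iff.2 ?_)
      filter_upwards [self_mem_nhdsWithin,
        nhdsWithin_le_nhds (eventually_coe_lt (t := 0) (by simpa using hT))] with s h1 h2
      exact ⟨(show (0 : ℝ) < s from h1).le, h2⟩
    refine le_of_tendsto ((huv.regular_v.tendsto_initial hT hx').sub_const (v₀ x)).abs ?_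
    filter_upwards [self_mem_nhdsWithin, hIoi hV,
      nhdsWithin_le_nhds (eventually_coe_lt (t := 0) (by simpa using hT))] with s hs hsV hsT
    have hs : (0 : ℝ) < s := hs
    have hv := huv.isNeumannRegular_v hs hsT
    have hd := hv.add hΩ (hw.const_smul hΩ (-1))
    have hcomp : ∀ σ : ℝ, |σ| = 1 → σ * (v s x - w k x) ≤ 2 * δ := by
      intro σ hσ
      have := (hd.const_smul hΩ σ).le_of_sub_laplacianWithin_le hΩ (M := 2 * δ) (by
        intro z hz
        have hz' := subset_closure hz
        rw [hd.laplacianWithin_smul hΩ _ hz',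
          hv.laplacianWithin_add hΩ (hw.const_smul hΩ (-1)) hz',
          hw.laplacianWithin_smul hΩ _ hz', hΩ.isOpen.laplacianWithin_closure (w k) hz]
        have e1 := huv.v_sub_laplacianWithin hΩ hs hsT hz
        have e2 := hk2 z hz
        have e3 := hVδ s hsV z hz'
        rw [mem_ofPred_eq, huv.initial z hz] at e3
        have e4 : |u s z - (w k z - Laplacian.laplacian (w k) z)| ≤ 2 * δ := by
          have := dist_triangle (u s z) (u₀ z) (w k z - Laplacian.laplacian (w k) z)
          rw [← Real.dist_eq]
          linarith
        have e5 : σ * (u s z - (w k z - Laplacian.laplacian (w k) z)) ≤ 2 * δ :=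
          (le_abs_self _).trans (by rw [abs_mul, hσ, one_mul]; exact e4)
        simp only [Pi.smul_apply, Pi.add_apply, smul_eq_mul]
        rw [← e1] at e5
        linarith) x hx'
      simp only [Pi.smul_apply, Pi.add_apply, smul_eq_mul] at this
      linarith
    have h1 := hcomp 1 (by norm_num)
    have h2 := hcomp (-1) (by norm_num)
    have h3 := hk1 x hx'
    rw [Real.dist_eq, abs_lt] at h3
    rw [abs_le]
    constructor <;> linarith [h3.1, h3.2]
  have h0 : |v 0 x - v₀ x| ≤ 0 := le_of_forall_pos_le_add fun ε hε => by
    have := key (ε / 3) (by positivity)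
    linarith
  exact sub_eq_zero.1 (abs_nonpos_iff.1 h0)

end Solution

/-! ### Non-negativity of `u` -/

section Nonneg

variable {n : ℕ} {Ω : Set (EuclideanSpace ℝ (Fin n))} {γ : ℝ → ℝ} {μ : ℝ}
  {u₀ : EuclideanSpace ℝ (Fin n) → ℝ} {T : EReal} {u v : ℝ → EuclideanSpace ℝ (Fin n) → ℝ}
  {t : ℝ}

/-- `u` is non-negative. In terms of `y = γ(v) u` the equation reads
`y_t = γ(v) Δ y + (μ (1 - u) + γ'(v) v_t / γ(v)) y`; as `γ' ≤ 0` and `v_t` is bounded below, the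
coefficient of `y` is bounded above on `[0,t]`, so that `exp (-λ s) y` has no negative minimum when
`λ` is large. The equation for `u` itself is of no use here: its coefficient `Δ γ(v)` is not known
to be bounded near `t = 0`. -/
theorem IsClassicalSolution.u_nonneg (huv : IsClassicalSolution Ω γ μ u₀ T u v)
    (hΩ : IsSmoothBoundedDomain Ω) (hγ : IsMotility γ) (hu₀ : IsInitialDatum Ω u₀)
    (h0 : 0 ≤ t) (ht : (t : EReal) < T) {x : EuclideanSpace ℝ (Fin n)} (hx : x ∈ closure Ω) :
    0 ≤ u t x := by
  by_contra hneg
  push Not at hneg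
  have hT : 0 < T := lt_of_le_of_lt (by exact_mod_cast h0) ht
  set Q : Set (ℝ × EuclideanSpace ℝ (Fin n)) := Icc 0 t ×ˢ closure Ω with hQ
  have hQc : IsCompact Q := isCompact_Icc.prod hΩ.isCompact_closure
  have hlt : ∀ s ∈ Icc 0 t, (s : EReal) < T := fun s hs =>
    lt_of_le_of_lt (by exact_mod_cast hs.2) ht
  have hsub : Q ⊆ {t : ℝ | 0 ≤ t ∧ (t : EReal) < T} ×ˢ closure Ω :=
    prod_mono (fun s hs => ⟨hs.1, hlt s hs⟩) subset_rfl
  have hcu : ContinuousOn (fun q : ℝ × EuclideanSpace ℝ (Fin n) => u q.1 q.2) Q :=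
    huv.regular_u.continuousOn.mono hsub
  have hcv : ContinuousOn (fun q : ℝ × EuclideanSpace ℝ (Fin n) => v q.1 q.2) Q :=
    huv.regular_v.continuousOn.mono hsub
  have hvQ : MapsTo (fun q : ℝ × EuclideanSpace ℝ (Fin n) => v q.1 q.2) Q (Ici 0) :=
    fun q hq => huv.v_nonneg hq.1.1 (hlt _ hq.1) hq.2
  have hcy : ContinuousOn (fun q : ℝ × EuclideanSpace ℝ (Fin n) => γ (v q.1 q.2) * u q.1 q.2) Q :=
    (hγ.contDiffOn.continuousOn.comp hcv hvQ).mul hcu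
  obtain ⟨Mu, hMu⟩ := hQc.exists_bound_of_continuousOn hcu
  obtain ⟨Mv, hMv⟩ := hQc.exists_bound_of_continuousOn hcv
  obtain ⟨My, hMy⟩ := hQc.exists_bound_of_continuousOn hcy
  obtain ⟨L, hL⟩ := hQc.exists_bound_of_continuousOn (hγ.continuousOn_derivWithin.comp hcv hvQ)
  simp only [Real.norm_eq_abs, Function.comp_apply] at hMu hMv hMy hL
  have hq0 : ((t, x) : ℝ × EuclideanSpace ℝ (Fin n)) ∈ Q := ⟨⟨h0, le_rfl⟩, hx⟩
  have hMu0 : 0 ≤ Mu := (abs_nonneg _).trans (hMu _ hq0)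
  have hMv0 : 0 ≤ Mv := (abs_nonneg _).trans (hMv _ hq0)
  have hMy0 : 0 ≤ My := (abs_nonneg _).trans (hMy _ hq0)
  have hL0 : 0 ≤ L := (abs_nonneg _).trans (hL _ hq0)
  have hg0 : 0 < γ Mv := hγ.pos_of_nonneg hMv0
  -- `v_t ≥ -K` on `(0,t]`
  set K := My + (My + |μ| * Mu * (1 + Mu)) with hK
  have hK0 : 0 ≤ K := by positivity
  set l := L * K / γ Mv + |μ| * (1 + Mu) + 1 with hl
  obtain ⟨⟨s, z⟩, hsz, hmin⟩ := hQc.exists_isMinOn ⟨_, hq0⟩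
    (f := fun q => Real.exp (-l * q.1) * (γ (v q.1 q.2) * u q.1 q.2))
    (ContinuousOn.mul (by fun_prop) hcy)
  have hs : s ∈ Icc 0 t := hsz.1
  have hz : z ∈ closure Ω := hsz.2
  have hsT := hlt s hs
  have hgs : 0 < γ (v s z) := hγ.pos_of_nonneg (hvQ hsz)
  have huneg : u s z < 0 := by
    have h1 : Real.exp (-l * s) * (γ (v s z) * u s z) ≤
        Real.exp (-l * t) * (γ (v t x) * u t x) := hmin hq0
    have h2 : Real.exp (-l * t) * (γ (v t x) * u t x) < 0 :=
      mul_neg_of_pos_of_neg (Real.exp_pos _)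
        (mul_neg_of_pos_of_neg (hγ.pos_of_nonneg (hvQ hq0)) hneg)
    by_contra hcon
    have h3 : 0 ≤ Real.exp (-l * s) * (γ (v s z) * u s z) :=
      mul_nonneg (Real.exp_pos _).le (mul_nonneg hgs.le (not_lt.1 hcon))
    linarith
  have hs0 : 0 < s := by
    rcases hs.1.eq_or_lt with h | h
    · rw [← h] at huneg
      exact absurd (huv.u_zero_nonneg hu₀ hT hz) (not_le.2 huneg)
    · exact h
  have hy := huv.isNeumannRegular_flux hΩ hγ hs0 hsT
  have hlap : 0 ≤ laplacianWithin (fun y => γ (v s y) * u s y) (closure Ω) z := by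
    refine hy.laplacianWithin_nonneg hΩ hz fun p hp => ?_
    have h1 : Real.exp (-l * s) * (γ (v s z) * u s z) ≤
        Real.exp (-l * s) * (γ (v s p) * u s p) := hmin (show (s, p) ∈ Q from ⟨hs, hp⟩)
    exact le_of_mul_le_mul_left h1 (Real.exp_pos _)
  have hut := huv.deriv_u_eq hΩ hγ hs0 hsT hz
  set vt := deriv (fun r => v r z) s with hvt
  set ut := deriv (fun r => u r z) s with hut'
  set g' := derivWithin γ (Ici 0) (v s z) with hg'
  have hvtK : -K ≤ vt := by
    have h1 := huv.mul_deriv_v_add_le hΩ hγ hs0 hsT (-1) 0 (My + |μ| * Mu * (1 + Mu))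
      (fun p hp => by
        have hp' : (s, p) ∈ Q := ⟨hs, subset_closure hp⟩
        have e1 := (abs_le.1 (hMy _ hp')).1
        have e2 : |μ * u s p * (1 - u s p)| ≤ |μ| * Mu * (1 + Mu) := by
          rw [abs_mul, abs_mul]
          have e3 : |1 - u s p| ≤ 1 + Mu := by
            have := abs_sub 1 (u s p)
            have e4 := hMu _ hp'
            rw [abs_one] at this
            simp only at e4
            linarith
          have e4 : |u s p| ≤ Mu := hMu _ hp'
          gcongr
        have e5 := (abs_le.1 e2).1
        simp only at e1
        linarith) hz
    have h2 := (abs_le.1 (hMy _ hsz)).2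
    simp only at h2
    linarith
  -- the one-sided derivative in time of `exp (-l s) y` at the minimum is non-positive
  have htime : g' * vt * u s z + γ (v s z) * ut ≤ l * (γ (v s z) * u s z) := by
    have hsubI : Icc 0 s ⊆ Icc 0 t := Icc_subset_Icc_right hs.2
    have d1 : HasDerivWithinAt (fun r => γ (v r z)) (g' * vt) (Icc 0 s) s :=
      HasDerivWithinAt.comp s (hγ.hasDerivWithinAt (hvQ hsz))
        (huv.regular_v.hasDerivAt hs0 hsT hz).hasDerivWithinAt
        (fun r hr => hvQ (show (r, z) ∈ Q from ⟨hsubI hr, hz⟩))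
    have d2 : HasDerivWithinAt (fun r => u r z) ut (Icc 0 s) s :=
      (huv.regular_u.hasDerivAt hs0 hsT hz).hasDerivWithinAt
    have d3 : HasDerivWithinAt (fun r : ℝ => Real.exp (-l * r)) (Real.exp (-l * s) * -l)
        (Icc 0 s) s := by
      simpa using (((hasDerivAt_id s).const_mul (-l)).exp).hasDerivWithinAt (s := Icc 0 s)
    have d4 := d3.mul (d1.mul d2)
    have hminI : IsMinOn ((fun r : ℝ => Real.exp (-l * r)) *
        ((fun r => γ (v r z)) * fun r => u r z)) (Icc 0 s) s :=
      fun r hr => hmin (show (r, z) ∈ Q from ⟨hsubI hr, hz⟩)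
    have h1 := hminI.localize.hasFDerivWithinAt_nonneg d4.hasFDerivWithinAt
      (sub_mem_posTangentConeAt_of_segment_subset (y := 0) (by
        rw [segment_symm, segment_eq_Icc hs0.le]))
    simp only [zero_sub, ContinuousLinearMap.toSpanSingleton_apply, smul_eq_mul,
      Pi.mul_apply] at h1
    have h2 : 0 ≤ (Real.exp (-l * s) * s) *
        (l * (γ (v s z) * u s z) - (g' * vt * u s z + γ (v s z) * ut)) := by
      linarith
    linarith [nonneg_of_mul_nonneg_right h2 (mul_pos (Real.exp_pos _) hs0)]
  have hcoef : l * γ (v s z) ≤ g' * vt + γ (v s z) * (μ * (1 - u s z)) := by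
    have h1 : (g' * vt + γ (v s z) * (μ * (1 - u s z))) * u s z ≤ l * γ (v s z) * u s z := by
      have h2 := mul_nonneg hgs.le hlap
      rw [hut] at htime
      linarith
    by_contra hcon
    exact absurd h1 (not_le.2 (mul_lt_mul_of_neg_right (not_le.1 hcon) huneg))
  have hg'0 : g' ≤ 0 := hγ.antitoneOn.derivWithin_nonpos
  have hb1 : g' * vt ≤ L * K := by
    have h1 : -g' ≤ L := (neg_le_abs g').trans (hL _ hsz)
    have h2 := mul_le_mul_of_nonpos_left hvtK hg'0
    have h3 := mul_le_mul_of_nonneg_right h1 hK0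
    linarith
  have hb2 : μ * (1 - u s z) ≤ |μ| * (1 + Mu) := by
    have h1 : -u s z ≤ Mu := (neg_le_abs _).trans (hMu _ hsz)
    exact mul_le_mul (le_abs_self μ) (by linarith) (by linarith) (abs_nonneg μ)
  have hb3 : L * K ≤ L * K / γ Mv * γ (v s z) := by
    have h1 : γ Mv ≤ γ (v s z) :=
      hγ.antitoneOn (hvQ hsz) hMv0 ((le_abs_self _).trans (hMv _ hsz))
    calc L * K = L * K / γ Mv * γ Mv := by field_simp
      _ ≤ L * K / γ Mv * γ (v s z) := by gcongr
  have hb4 := mul_le_mul_of_nonneg_left hb2 hgs.le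
  rw [hl] at hcoef
  linarith

end Nonneg

/-! ### The upper bound for `v` -/

theorem lemma3p6 {n : ℕ} (hn : 1 ≤ n)
    (Ω : Set (EuclideanSpace ℝ (Fin n))) (hΩ : IsSmoothBoundedDomain Ω)
    (γ : ℝ → ℝ) (hγ : IsMotility γ)
    (u₀ : EuclideanSpace ℝ (Fin n) → ℝ) (hu₀ : IsInitialDatum Ω u₀)
    (v₀ : EuclideanSpace ℝ (Fin n) → ℝ) (hv₀ : IsNeumannResolvent Ω u₀ v₀)
    (μ : ℝ) (T : EReal) (hT : 0 < T)
    (u v : ℝ → EuclideanSpace ℝ (Fin n) → ℝ) (huv : IsClassicalSolution Ω γ μ u₀ T u v)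
    (vstar : ℝ) (hvstar : 0 ≤ vstar)
    (hlower : vstar = 0 ∨ ∀ t : ℝ, 0 < t → (t : EReal) < T → ∀ x ∈ Ω, vstar ≤ v t x)
    (hμ : γ vstar < μ) :
    ∀ t : ℝ, 0 ≤ t → (t : EReal) < T → ∀ x ∈ Ω, v t x ≤ v₀ x + μ / (μ - γ vstar) := by
  intro t h0 ht x hx
  have hx' := subset_closure hx
  have hgpos : 0 < γ vstar := hγ.pos_of_nonneg hvstar
  have hμ0 : 0 < μ := hgpos.trans hμ
  have hlt : ∀ s ∈ Icc 0 t, (s : EReal) < T := fun s hs =>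
    lt_of_le_of_lt (by exact_mod_cast hs.2) ht
  -- a general rate `k` gives the bound `(c + k) ^ 2 / (4 μ k)`, which is smallest for `k = c`
  set c := γ vstar + μ with hc
  have hc0 : 0 < c := by positivity
  have hineq : ∀ s ∈ Ioo 0 t, deriv (fun r => v r x) s + c * v s x ≤ c ^ 2 / μ := by
    intro s hs
    have hsT := hlt s ⟨hs.1.le, hs.2.le⟩
    have hu : ∀ y ∈ closure Ω, 0 ≤ u s y := fun y hy => huv.u_nonneg hΩ hγ hu₀ hs.1.le hsT hy
    have h1 := huv.mul_deriv_v_add_le hΩ hγ hs.1 hsT 1 c (c ^ 2 / μ) (fun y hy => by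
      have hvy := huv.mem_domain s hs.1 hsT y hy
      have hle : vstar ≤ v s y := by
        rcases hlower with h | h
        · rw [h]; exact hvy
        · exact h s hs.1 hsT y hy
      have h2 := mul_le_mul_of_nonneg_right (hγ.antitoneOn hvstar hvy hle)
        (hu y (subset_closure hy))
      rw [le_div_iff₀ hμ0]
      -- `2 c u - μ u ^ 2 ≤ c ^ 2 / μ`
      nlinarith [sq_nonneg (c - μ * u s y), mul_le_mul_of_nonneg_right h2 hμ0.le]) hx'
    have h3 : 0 ≤ γ (v s x) * u s x :=
      mul_nonneg (hγ.pos_of_nonneg (huv.mem_domain s hs.1 hsT x hx)).le (hu x hx')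
    linarith
  have hanti : AntitoneOn (fun s => Real.exp (c * s) * (v s x - c / μ)) (Icc 0 t) := by
    have hd : ∀ s ∈ Ioo 0 t, HasDerivAt (fun s => Real.exp (c * s) * (v s x - c / μ))
        (Real.exp (c * s) * c * (v s x - c / μ) +
          Real.exp (c * s) * deriv (fun r => v r x) s) s := fun s hs => by
      have d1 : HasDerivAt (fun r : ℝ => Real.exp (c * r)) (Real.exp (c * s) * c) s := by
        simpa using ((hasDerivAt_id s).const_mul c).exp
      exact d1.mul ((huv.regular_v.hasDerivAt hs.1 (hlt s ⟨hs.1.le, hs.2.le⟩)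
        hx').sub_const (c / μ))
    refine antitoneOn_of_deriv_nonpos (convex_Icc 0 t) ?_ ?_ ?_
    · refine ContinuousOn.mul (by fun_prop) (ContinuousOn.sub ?_ continuousOn_const)
      exact (huv.regular_v.continuousOn_time hx').mono fun s hs => ⟨hs.1, hlt s hs⟩
    · rw [interior_Icc]
      exact fun s hs => (hd s hs).differentiableAt.differentiableWithinAt
    · rw [interior_Icc]
      intro s hs
      rw [(hd s hs).deriv]
      have h1 := hineq s hs
      have h2 : Real.exp (c * s) * c * (v s x - c / μ) +
          Real.exp (c * s) * deriv (fun r => v r x) s =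
          Real.exp (c * s) * (deriv (fun r => v r x) s + c * v s x - c ^ 2 / μ) := by ring
      rw [h2]
      exact mul_nonpos_of_nonneg_of_nonpos (Real.exp_pos _).le (by linarith)
  have hfin := hanti (left_mem_Icc.2 h0) (right_mem_Icc.2 h0) h0
  have hv0 : 0 ≤ v 0 x := huv.v_nonneg le_rfl (by simpa using hT) hx'
  simp only [mul_zero, Real.exp_zero, one_mul] at hfin
  have hcμ : c / μ ≤ μ / (μ - γ vstar) := by
    rw [div_le_div_iff₀ hμ0 (by linarith)]
    nlinarith [sq_nonneg (γ vstar)]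
  have hexp : 1 ≤ Real.exp (c * t) := Real.one_le_exp (by positivity)
  have hbound : v t x - c / μ ≤ v 0 x := by
    by_contra hcon
    push Not at hcon
    have h1 := mul_le_mul_of_nonneg_right hexp (hv0.trans hcon.le)
    have : 0 < c / μ := by positivity
    linarith
  rw [← huv.v_zero_eq hΩ hT hv₀ hx]
  linarith
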